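/- Maps are continuous maps of topological spaces, and $S^1$ is the unit circle in $\mathbb C$ based at $1$. For a (discrete) group $G$, a delooping $BG$ of $G$ is a path-connected space with a base point $\ast$, together with a homotopy equivalence $\Omega BG=\Omega(BG,\ast)\simeq G$ that sends concatenation of loops to the group operation. A pointed map $f:(A,a)\to(B,b)$ is a map $f$ together with a path $\beta$ from $f(a)$ to $b$; it induces $\Omega f:\Omega A\to\Omega B$, $p\mapsto\beta^{-1}\cdot f(p)\cdot\beta$. Given deloopings $BG$, $BH$ and a group morphism $\phi:G\to H$, a delooping $B\phi:BG\to BH$ of $\phi$ is a pointed map for which $\Omega B\phi$ corresponds to $\phi$ under $\Omega BG\simeq G$ and $\Omega BH\simeq H$. The circle is regarded as the delooping $B\mathbb Z$ of $\mathbb Z$, by the winding number. The fiber $\mathrm{fib}_f$ of a map $f:E\to B$ at the base point $b$ of $B$ is the homotopy fiber, i.e. the space of pairs of a point $x\in E$ and a path in $B$ from $f(x)$ to $b$. A sequence $F\xrightarrow{i}E\xrightarrow{f}B$ is a fiber sequence if there is a homotopy from $f\circ i$ to the constant map at $b$ such that the induced map $F\to\mathrm{fib}_f$ is a homotopy equivalence.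 For a natural number $k$, $kA$ is the disjoint union of $k$ copies of a space $A$, and, for $g:A\to B$, $kg:kA\to B$ is the map equal to $g$ on each copy. **Proposition.** Let $m\ge 1$ be an integer, let $l$ be an arbitrary integer, and let $k=\gcd(l,m)$. Let $B\mathbb Z_m$ be any delooping of $\mathbb Z_m=\mathbb Z/m\mathbb Z$, and let $B\phi^l:S^1\to B\mathbb Z_m$ be any delooping of the group morphism $\phi^l:\mathbb Z\to\mathbb Z_m$ with $\phi^l(1)=l$. Then the fiber of $B\phi^l$ at the base point is homotopy equivalent to $kS^1$. Moreover, for any delooping $B\mu_{m/k}:S^1\to S^1$ of the multiplication $\mu_{m/k}:\mathbb Z\to\mathbb Z$ by $m/k$, $$kS^1\xrightarrow{\;kB\mu_{m/k}\;}S^1\xrightarrow{\;B\phi^l\;}B\mathbb Z_m$$ is a fiber sequence. -/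

import Mathlib

open scoped ContinuousMap unitInterval

noncomputable section

namespace FibSeq

/-! ### Pointed maps, deloopings of groups and of group morphisms -/

/-- A pointed map from `(A, a)` to `(B, b)`: a continuous map `f` with a path from `f a` to `b`. -/
structure PointedMap {A B : Type*} [TopologicalSpace A] [TopologicalSpace B] (a : A) (b : B) where
  toMap : C(A, B)
  basePath : Path (toMap a) b

/-- The map induced by a pointed map on loop spaces: `p ↦ basePath⁻¹ ⬝ f(p) ⬝ basePath`. -/
def PointedMap.loopMap {A B : Type*} [TopologicalSpace A] [TopologicalSpace B] {a : A} {b : B}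
    (f : PointedMap a b) (p : Path a a) : Path b b :=
  f.basePath.symm.trans ((p.map f.toMap.continuous).trans f.basePath)

/-- A delooping of a (discrete, additively written) group `G` on a space `X`: `X` is path-connected
with a base point, and its loop space is homotopy equivalent to `G` by an equivalence
which sends concatenation of loops to addition. -/
structure Delooping (G : Type*) [AddGroup G] [TopologicalSpace G] [DiscreteTopology G]
    (X : Type*) [TopologicalSpace X] where
  base : X
  connected : PathConnectedSpace X
  loopEquiv : Path base base ≃ₕ G
  loopEquiv_trans : ∀ p q : Path base base,
    loopEquiv (p.trans q) = loopEquiv p + loopEquiv q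

/-- The pointed map `f : BG → BH` deloops the group morphism `φ : G → H`:
the map induced by `f` on loop spaces corresponds to `φ` under `ΩBG ≃ G` and `ΩBH ≃ H`. -/
def Deloops {G H X Y : Type*} [AddGroup G] [TopologicalSpace G] [DiscreteTopology G]
    [AddGroup H] [TopologicalSpace H] [DiscreteTopology H]
    [TopologicalSpace X] [TopologicalSpace Y]
    (BG : Delooping G X) (BH : Delooping H Y) (f : PointedMap BG.base BH.base) (φ : G →+ H) :
    Prop :=
  ∀ p : Path BG.base BG.base, BH.loopEquiv (f.loopMap p) = φ (BG.loopEquiv p)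

/-! ### Fibers, fiber sequences, disjoint copies -/

/-- The homotopy fiber of `f` at `b`: the space of pairs of a point `x` of `E` and
a path in `B` from `f x` to `b`. -/
def HFiber {E B : Type*} [TopologicalSpace E] [TopologicalSpace B] (f : C(E, B)) (b : B) : Type _ :=
  {p : E × C(I, B) // p.2 0 = f p.1 ∧ p.2 1 = b}

instance {E B : Type*} [TopologicalSpace E] [TopologicalSpace B] (f : C(E, B)) (b : B) :
    TopologicalSpace (HFiber f b) :=
  inferInstanceAs (TopologicalSpace {p : E × C(I, B) // p.2 0 = f p.1 ∧ p.2 1 = b})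

/-- The map to the homotopy fiber induced by a map `i : F → E` and
a homotopy from `f ∘ i` to the constant map at `b`. -/
def toHFiber {F E B : Type*} [TopologicalSpace F] [TopologicalSpace E] [TopologicalSpace B]
    (i : C(F, E)) (f : C(E, B)) (b : B)
    (H : (f.comp i).Homotopy (ContinuousMap.const F b)) : C(F, HFiber f b) where
  toFun x := ⟨(i x, (H.toContinuousMap.comp ContinuousMap.prodSwap).curry x),
    H.apply_zero x, H.apply_one x⟩
  continuous_toFun := Continuous.subtype_mk
    (i.continuous.prodMk (ContinuousMap.continuous _)) _

/-- `F --i--> E --f--> B` is a (homotopy) fiber sequence over the base point `b`: there is a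
homotopy from `f ∘ i` to the constant map at `b` for which the induced map from `F` to the
homotopy fiber of `f` is a homotopy equivalence, i.e. `i` is the homotopy pullback of `b : 1 → B`
along `f`. -/
def IsFiberSequence {F E B : Type*} [TopologicalSpace F] [TopologicalSpace E] [TopologicalSpace B]
    (i : C(F, E)) (f : C(E, B)) (b : B) : Prop :=
  ∃ (H : (f.comp i).Homotopy (ContinuousMap.const F b)) (e : F ≃ₕ HFiber f b),
    e.toFun = toHFiber i f b H

/-- The space `k A`, the disjoint union of `k` copies of `A`. -/
abbrev Copies (k : ℕ) (A : Type*) : Type _ := Σ _ : Fin k, A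

/-- The map `k A → B` which is `g : A → B` on each copy of `A`. -/
def copiesMap (k : ℕ) {A B : Type*} [TopologicalSpace A] [TopologicalSpace B] (g : C(A, B)) :
    C(Copies k A, B) where
  toFun x := g x.2
  continuous_toFun := continuous_sigma fun _ => g.continuous

/-! ### The circle as a delooping of `ℤ` -/

/-- The lift to `ℝ`, starting at `0`, of a loop of the circle, along `t ↦ exp (t * I)`. -/
def angleLift (γ : Path (1 : Circle) 1) : C(I, ℝ) :=
  Circle.isCoveringMap_exp.liftPath γ 0 (by simp)

theorem exp_angleLift (γ : Path (1 : Circle) 1) (t : I) : Circle.exp (angleLift γ t) = γ t :=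
  congrFun (Circle.isCoveringMap_exp.liftPath_lifts (γ : C(I, Circle)) 0 (by simp)) t

theorem angleLift_zero (γ : Path (1 : Circle) 1) : angleLift γ 0 = 0 :=
  Circle.isCoveringMap_exp.liftPath_zero (γ : C(I, Circle)) 0 (by simp)

theorem angleLift_eq (γ : Path (1 : Circle) 1) (Γ : C(I, ℝ)) (h : ∀ t, Circle.exp (Γ t) = γ t)
    (h0 : Γ 0 = 0) : angleLift γ = Γ :=
  ((Circle.isCoveringMap_exp.eq_liftPath_iff' (γ := (γ : C(I, Circle))) (e := (0 : ℝ))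
    (by simp)).2 ⟨funext h, h0⟩).symm

theorem continuous_angleLift :
    Continuous fun x : I × Path (1 : Circle) 1 => angleLift x.2 x.1 :=
  (Circle.isCoveringMap_exp.liftHomotopy
    (A := Path (1 : Circle) 1)
    (⟨fun x => x.2 x.1, by fun_prop⟩ : C(I × Path (1 : Circle) 1, Circle))
    (ContinuousMap.const _ 0) (by simp)).continuous

theorem exists_angleLift_one (γ : Path (1 : Circle) 1) :
    ∃ n : ℤ, angleLift γ 1 = n * (2 * Real.pi) :=
  Circle.exp_eq_one.1 ((exp_angleLift γ 1).trans γ.target)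

/-- The winding number of a loop of the circle. -/
def winding (γ : Path (1 : Circle) 1) : ℤ := (exists_angleLift_one γ).choose

theorem winding_spec (γ : Path (1 : Circle) 1) :
    angleLift γ 1 = winding γ * (2 * Real.pi) :=
  (exists_angleLift_one γ).choose_spec

theorem winding_eq (γ : Path (1 : Circle) 1) (n : ℤ) (h : angleLift γ 1 = n * (2 * Real.pi)) :
    winding γ = n := by
  have := (winding_spec γ).symm.trans h
  exact_mod_cast mul_right_cancel₀ Real.two_pi_pos.ne' this

theorem continuous_winding : Continuous winding := by
  rw [Int.isClosedEmbedding_coe_real.isEmbedding.continuous_iff]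
  have h : (fun γ : Path (1 : Circle) 1 => angleLift γ 1 / (2 * Real.pi)) =
      (fun n : ℤ => (n : ℝ)) ∘ winding := by
    funext γ
    simp [winding_spec, Real.pi_ne_zero]
  rw [← h]
  exact (continuous_angleLift.comp (Continuous.prodMk_right (1 : I))).div_const _

/-- The loop `t ↦ exp (2 π n t i)` of the circle. -/
def circleLoop (n : ℤ) : Path (1 : Circle) 1 where
  toFun t := Circle.exp (t * (n * (2 * Real.pi)))
  continuous_toFun := by fun_prop
  source' := by simp
  target' := by simp

theorem angleLift_circleLoop (n : ℤ) (t : I) :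
    angleLift (circleLoop n) t = t * (n * (2 * Real.pi)) := by
  rw [angleLift_eq (circleLoop n) ⟨fun t => t * (n * (2 * Real.pi)), by fun_prop⟩
    (fun _ => rfl) (by simp)]
  rfl

theorem winding_circleLoop (n : ℤ) : winding (circleLoop n) = n :=
  winding_eq _ _ (by simp [angleLift_circleLoop])

theorem winding_trans (p q : Path (1 : Circle) 1) :
    winding (p.trans q) = winding p + winding q := by
  let P : Path (0 : ℝ) (angleLift p 1) := ⟨angleLift p, angleLift_zero p, rfl⟩
  let Q : Path (angleLift p 1) (angleLift p 1 + angleLift q 1) :=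
    ⟨⟨fun t => angleLift p 1 + angleLift q t, by fun_prop⟩, by simp [angleLift_zero], rfl⟩
  apply winding_eq
  rw [angleLift_eq (p.trans q) (P.trans Q : Path _ _)]
  · simp only [ContinuousMap.coe_coe, Path.target]
    rw [winding_spec, winding_spec]
    push_cast
    ring
  · intro t
    simp only [ContinuousMap.coe_coe, Path.trans_apply]
    split_ifs
    · exact exp_angleLift p _
    · change Circle.exp (angleLift p 1 + angleLift q _) = _
      rw [Circle.exp_add, exp_angleLift, exp_angleLift, p.target, one_mul]
  · simp

/-- The straight-line homotopy between the lifts of a loop of the circle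
and of the standard loop with the same winding number. -/
def straighten (s : I) (γ : Path (1 : Circle) 1) : Path (1 : Circle) 1 where
  toFun t := Circle.exp ((1 - s) * (t * (winding γ * (2 * Real.pi))) + s * angleLift γ t)
  continuous_toFun := by fun_prop
  source' := by simp [angleLift_zero]
  target' := by
    rw [winding_spec]
    have : (1 - (s : ℝ)) * (((1 : I) : ℝ) * (winding γ * (2 * Real.pi)))
        + s * (winding γ * (2 * Real.pi)) = winding γ * (2 * Real.pi) := by
      simp only [Set.Icc.coe_one]
      ring
    rw [this]
    exact Circle.exp_int_mul_two_pi _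

theorem continuous_straighten :
    Continuous fun x : I × Path (1 : Circle) 1 => straighten x.1 x.2 := by
  rw [← Path.continuous_uncurry_iff]
  have h1 : Continuous fun x : (I × Path (1 : Circle) 1) × I => (winding x.1.2 : ℝ) :=
    Int.isClosedEmbedding_coe_real.continuous.comp
      (continuous_winding.comp (continuous_snd.comp continuous_fst))
  have h2 : Continuous fun x : (I × Path (1 : Circle) 1) × I => angleLift x.1.2 x.2 :=
    continuous_angleLift.comp (continuous_snd.prodMk (continuous_snd.comp continuous_fst))
  refine Circle.exp.continuous.comp (f := fun x : (I × Path (1 : Circle) 1) × I =>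
    (1 - (x.1.1 : ℝ)) * (x.2 * (winding x.1.2 * (2 * Real.pi))) + x.1.1 * angleLift x.1.2 x.2) ?_
  fun_prop

/-- The loop space of the circle is homotopy equivalent to `ℤ`, by the winding number. -/
def circleLoopEquiv : Path (1 : Circle) 1 ≃ₕ ℤ where
  toFun := ⟨winding, continuous_winding⟩
  invFun := ⟨circleLoop, continuous_of_discreteTopology⟩
  left_inv := ⟨{
    toFun := fun x => straighten x.1 x.2
    continuous_toFun := continuous_straighten
    map_zero_left := fun γ => by
      ext t
      simp [straighten, circleLoop]
    map_one_left := fun γ => by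
      ext t
      simp [straighten, exp_angleLift] }⟩
  right_inv := by
    have : (ContinuousMap.comp ⟨winding, continuous_winding⟩
        ⟨circleLoop, continuous_of_discreteTopology⟩ : C(ℤ, ℤ)) = ContinuousMap.id ℤ := by
      ext n
      exact winding_circleLoop n
    rw [this]

/-- The circle, with base point `1`, as a delooping of `ℤ`: the loop `t ↦ exp (2 π n t i)`
corresponds to `n`. -/
def circleDelooping : Delooping ℤ Circle where
  base := 1
  connected := Circle.exp_surjective.pathConnectedSpace Circle.exp.continuous
  loopEquiv := circleLoopEquiv
  loopEquiv_trans := winding_trans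

end FibSeq

end

/-! The order `n` of `c = φ 1` is such that `f : S¹ → BG` becomes null-homotopic after composition
with the power map `z ↦ zⁿ`, so that the homotopy fiber of the composite is homotopy equivalent to
`S¹ × G`. A point of the homotopy fiber of `f` has `n` lifts to this space, one for each `n`-th root
of its underlying point, and rotating the root by `2πa/n` adds `a • c` to the component in `G`.
Hence the points whose component in `G` belongs to a given set of representatives of the cosets of
`⟨c⟩` form a clopen subset, equivalent to a disjoint union of copies of `S¹`, which is mapped
homeomorphically onto the homotopy fiber of `f`. -/

noncomputable section

namespace FibSeq

/-! ### Clopen subsets -/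

theorem homotopy_apply_mem_clopen_iff {Y Z : Type*} [TopologicalSpace Y] [TopologicalSpace Z]
    {f g : C(Y, Z)} (F : f.Homotopy g) {U : Set Z} (hU : IsClopen U) (t : I) (y : Y) :
    F (t, y) ∈ U ↔ g y ∈ U := by
  have hclopen : IsClopen ((fun t => F (t, y)) ⁻¹' U) := hU.preimage (by fun_prop)
  rw [← F.apply_one y]
  rcases isClopen_iff.1 hclopen with h | h
  · exact iff_of_false (Set.eq_empty_iff_forall_notMem.1 h t)
      (Set.eq_empty_iff_forall_notMem.1 h 1)
  · exact iff_of_true (Set.eq_univ_iff_forall.1 h t) (Set.eq_univ_iff_forall.1 h 1)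

/-- The restriction to a clopen subset of a homotopy from a self-map to the identity. -/
def restrictHomotopy {Y : Type*} [TopologicalSpace Y] {f : C(Y, Y)}
    (F : f.Homotopy (ContinuousMap.id Y)) {U : Set Y} (hU : IsClopen U) {f' : C(U, U)}
    (hf' : ∀ y, (f' y : Y) = f y) : f'.Homotopy (ContinuousMap.id U) where
  toFun x := ⟨F (x.1, x.2), (homotopy_apply_mem_clopen_iff F hU x.1 x.2).2 x.2.2⟩
  map_zero_left y := Subtype.ext ((F.apply_zero y).trans (hf' y).symm)
  map_one_left y := Subtype.ext (F.apply_one y)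

/-- The homotopy equivalence induced by `e : Y ≃ₕ Z` between the preimage of a clopen subset of `Z`
and this subset. -/
def restrictClopen {Y Z : Type*} [TopologicalSpace Y] [TopologicalSpace Z] (e : Y ≃ₕ Z)
    {U : Set Z} (hU : IsClopen U) : e ⁻¹' U ≃ₕ U where
  toFun := ⟨fun y => ⟨e y, y.2⟩, by fun_prop⟩
  invFun := ⟨fun z => ⟨e.symm z, by
      obtain ⟨F⟩ := e.right_inv
      exact (F.apply_zero z ▸ homotopy_apply_mem_clopen_iff F hU 0 z).2 z.2⟩, by fun_prop⟩
  left_inv := e.left_inv.map fun F => restrictHomotopy F (hU.preimage e.continuous) fun _ => rfl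
  right_inv := e.right_inv.map fun F => restrictHomotopy F hU fun _ => rfl

/-! ### Paths -/

section Paths

variable {Y : Type*} [TopologicalSpace Y] {a b c : Y}

/-- The homotopy, in the parameter `s`, from `p ⬝ (p⁻¹ ⬝ q)` to `q`. It interpolates linearly
between the reparametrizations `t ↦ max (1 / 2 - t) (2 * t - 1)` and `t ↦ (1 + t) / 2` of `p⁻¹ ⬝ q`
which yield these two paths. -/
def cancelLeft (p : Path a b) (q : Path a c) (s : I) : Path a c where
  toFun t := (p.symm.trans q).extend
    ((1 - s) * max (1 / 2 - t : ℝ) (2 * t - 1) + s * ((1 + t) / 2))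
  continuous_toFun := by
    have := (p.symm.trans q).continuous_extend
    fun_prop
  source' := by
    have h : (1 - (s : ℝ)) * max (1 / 2 - ((0 : I) : ℝ)) (2 * ((0 : I) : ℝ) - 1)
        + s * ((1 + ((0 : I) : ℝ)) / 2) = 1 / 2 := by
      rw [max_eq_left] <;> norm_num
      ring
    rw [h, Path.extend_trans_of_le_half _ _ le_rfl]
    norm_num
  target' := by
    have h : (1 - (s : ℝ)) * max (1 / 2 - ((1 : I) : ℝ)) (2 * ((1 : I) : ℝ) - 1)
        + s * ((1 + ((1 : I) : ℝ)) / 2) = 1 := by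
      rw [max_eq_right] <;> norm_num
    rw [h, Path.extend_one]

theorem cancelLeft_zero (p : Path a b) (q : Path a c) :
    cancelLeft p q 0 = p.trans (p.symm.trans q) := by
  ext t
  rw [← Path.extend_extends' (p.trans _)]
  simp only [cancelLeft, Path.coe_mk_mk, Set.Icc.coe_zero, sub_zero, one_mul, zero_mul, add_zero]
  have h0 := t.2.1
  rcases le_total (t : ℝ) (1 / 2) with h | h
  · rw [max_eq_left (by linarith), Path.extend_trans_of_le_half _ _ (by linarith),
      Path.extend_trans_of_le_half _ _ h, Path.extend_symm_apply]
    congr 1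
    ring
  · rw [max_eq_right (by linarith), Path.extend_trans_of_half_le _ _ h]

theorem cancelLeft_one (p : Path a b) (q : Path a c) : cancelLeft p q 1 = q := by
  ext t
  rw [← Path.extend_extends' q]
  have h0 := t.2.1
  simp only [cancelLeft, Path.coe_mk_mk, Set.Icc.coe_one, sub_self, one_mul, zero_mul, zero_add]
  rw [Path.extend_trans_of_half_le _ _ (by linarith)]
  congr 1
  ring

theorem continuous_cancelLeft {T : Type*} [TopologicalSpace T] {a b c : T → Y}
    {p : ∀ y, Path (a y) (b y)} {q : ∀ y, Path (a y) (c y)} (hp : Continuous ↿p)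
    (hq : Continuous ↿q) :
    Continuous ↿fun x : I × T => cancelLeft (p x.2) (q x.2) x.1 := by
  have h := Path.trans_continuous_family _ (Path.symm_continuous_family _ hp) _ hq
  exact (Path.continuous_uncurry_extend_of_continuous_family _ h).comp
    (f := fun x : (I × T) × I => (x.1.2, (1 - (x.1.1 : ℝ)) * max (1 / 2 - x.2 : ℝ) (2 * x.2 - 1)
      + x.1.1 * ((1 + x.2) / 2))) (by fun_prop)

/-- The path `p ⬝ q` from its point at time `s / 2` on. -/
def dropInitial (p : Path a b) (q : Path b c) (s : I) : Path (p s) c where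
  toFun t := (p.trans q).extend (s / 2 + t * (1 - s / 2))
  continuous_toFun := by
    have := (p.trans q).continuous_extend
    fun_prop
  source' := by
    have := s.2.2
    rw [Path.extend_trans_of_le_half _ _ (by norm_num; linarith), ← Path.extend_extends' p]
    congr 1
    norm_num
    ring
  target' := by simp

theorem dropInitial_one (p : Path a b) (q : Path b c) (t : I) : dropInitial p q 1 t = q t := by
  rw [← Path.extend_extends' q]
  have h0 := t.2.1
  simp only [dropInitial, Path.coe_mk_mk, Set.Icc.coe_one]
  rw [Path.extend_trans_of_half_le _ _ (by linarith)]
  congr 1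
  ring

theorem continuous_dropInitial {T : Type*} [TopologicalSpace T] {a b c : T → Y}
    {p : ∀ y, Path (a y) (b y)} {q : ∀ y, Path (b y) (c y)} (hp : Continuous ↿p)
    (hq : Continuous ↿q) :
    Continuous ↿fun x : I × T => dropInitial (p x.2) (q x.2) x.1 := by
  have h := Path.trans_continuous_family _ hp _ hq
  exact (Path.continuous_uncurry_extend_of_continuous_family _ h).comp
    (f := fun x : (I × T) × I => (x.1.2, (x.1.1 / 2 + x.2 * (1 - x.1.1 / 2) : ℝ))) (by fun_prop)

open Path.Homotopic.Quotient in
theorem symm_trans_homotopic_of_trans_homotopic {α : Path a a} {β β' : Path a b}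
    (h : (α.trans β').Homotopic β) (γ : Path a b) :
    (β'.symm.trans γ).Homotopic ((β.symm.trans (α.trans β)).trans (β.symm.trans γ)) := by
  rw [← Path.Homotopic.Quotient.eq] at h ⊢
  simp only [mk_trans, mk_symm] at h ⊢
  have hβ' : symm (mk β') = (symm (mk β)).trans (mk α) := by
    calc symm (mk β') = ((symm (mk β)).trans ((mk α).trans (mk β'))).trans (symm (mk β')) := by
          rw [h, symm_trans, refl_trans]
      _ = (symm (mk β)).trans (mk α) := by simp only [trans_assoc, trans_symm, trans_refl]
  rw [hβ']
  simp only [trans_assoc]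
  rw [← trans_assoc (mk β) (symm (mk β)), trans_symm, refl_trans]

end Paths

theorem continuous_evalAt {E B : Type*} [TopologicalSpace E] [TopologicalSpace B] {f g : C(E, B)}
    (K : f.Homotopy g) : Continuous ↿fun x => K.evalAt x :=
  K.continuous.comp continuous_swap

namespace Delooping

variable {G : Type*} [AddGroup G] [TopologicalSpace G] [DiscreteTopology G]
  {X : Type*} [TopologicalSpace X] (D : Delooping G X)

theorem homotopic_loopEquiv_symm (p : Path D.base D.base) :
    (D.loopEquiv.symm (D.loopEquiv p)).Homotopic p := by
  obtain ⟨H⟩ := D.loopEquiv.left_inv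
  exact ⟨{
    toFun := fun x => H (x.1, p) x.2
    map_zero_left := fun t => by simp
    map_one_left := fun t => by simp
    prop' := by rintro t x (rfl | rfl) <;> simp }⟩

theorem loopEquiv_eq_iff {p q : Path D.base D.base} :
    D.loopEquiv p = D.loopEquiv q ↔ p.Homotopic q := by
  refine ⟨fun h => (D.homotopic_loopEquiv_symm p).symm.trans (h ▸ D.homotopic_loopEquiv_symm q), ?_⟩
  rintro ⟨H⟩
  have hc : Continuous fun t : I => H.eval t := Path.continuous_uncurry_iff.1 H.continuous
  simpa using PreconnectedSpace.constant (Y := G) inferInstance (D.loopEquiv.continuous.comp hc)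
    (x := 0) (y := 1)

theorem loopEquiv_refl : D.loopEquiv (Path.refl D.base) = 0 := by
  have h := D.loopEquiv_trans (Path.refl _) (Path.refl _)
  rw [Path.refl_trans_refl] at h
  simpa using h

end Delooping

namespace HFiber

variable {E B : Type*} [TopologicalSpace E] [TopologicalSpace B] {f : C(E, B)} {b : B}

/-- The point of the total space underlying a point of the homotopy fiber. -/
def point (y : HFiber f b) : E := y.1.1

/-- The path underlying a point of the homotopy fiber. -/
def path (y : HFiber f b) : Path (f y.point) b := ⟨y.1.2, y.2.1, y.2.2⟩

/-- The point of the homotopy fiber given by a point of the total space and a path. -/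
def mk (x : E) (p : Path (f x) b) : HFiber f b := ⟨(x, p.toContinuousMap), p.source, p.target⟩

theorem ext {y y' : HFiber f b} (h : y.point = y'.point) (h' : ∀ t, y.path t = y'.path t) :
    y = y' :=
  Subtype.ext (Prod.ext h (ContinuousMap.ext h'))

theorem continuous_point : Continuous (point : HFiber f b → E) :=
  continuous_fst.comp continuous_subtype_val

theorem continuous_path : Continuous ↿(fun y : HFiber f b => y.path) := by
  have h : Continuous fun x : HFiber f b × I => x.1.1.2 x.2 :=
    ((continuous_snd.comp continuous_subtype_val).comp continuous_fst).eval continuous_snd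
  exact h

theorem continuous_mk {T : Type*} [TopologicalSpace T] {u : T → E} (hu : Continuous u)
    {P : ∀ y, Path (f (u y)) b} (hP : Continuous ↿P) :
    Continuous fun y => (mk (u y) (P y) : HFiber f b) :=
  Continuous.subtype_mk
    (hu.prodMk (ContinuousMap.curry ⟨fun x : T × I => P x.1 x.2, hP⟩).continuous) _

variable {E' : Type*} [TopologicalSpace E']

/-- The map of homotopy fibers given by a map `p` of total spaces. -/
def total (p : C(E', E)) (y : HFiber (f.comp p) b) : HFiber f b :=
  mk (p y.point) y.path

theorem continuous_total (p : C(E', E)) :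
    Continuous (total p : HFiber (f.comp p) b → HFiber f b) :=
  continuous_mk (p.continuous.comp continuous_point) continuous_path

theorem isClosedMap_total {p : C(E', E)} (hp : IsProperMap p) :
    IsClosedMap (total p : HFiber (f.comp p) b → HFiber f b) :=
  (hp.universally_closed C(I, B)).restrictPreimage
    {q : E × C(I, B) | q.2 0 = f q.1 ∧ q.2 1 = b}

theorem ext_total {p : C(E', E)} {y y' : HFiber (f.comp p) b} (h : y.point = y'.point)
    (h' : y.total p = y'.total p) : y = y' :=
  ext h fun t => congrArg (fun z : HFiber f b => z.path t) h'

theorem exists_total_eq {p : C(E', E)} (y : HFiber f b) {x : E'} (hx : p x = y.point) :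
    ∃ y' : HFiber (f.comp p) b, y'.total p = y ∧ y'.point = x :=
  ⟨mk x (y.path.cast (congrArg f hx) rfl), ext hx fun _ => rfl, rfl⟩

end HFiber

/-! ### Fiber sequences -/

section FiberSequence

variable {F E B : Type*} [TopologicalSpace F] [TopologicalSpace E] [TopologicalSpace B]
  {i i' : C(F, E)} {f : C(E, B)} {b : B}

theorem exists_toHFiber_homotopic (J : i'.Homotopy i)
    (H : (f.comp i).Homotopy (ContinuousMap.const F b)) :
    ∃ H' : (f.comp i').Homotopy (ContinuousMap.const F b),
      (toHFiber i' f b H').Homotopic (toHFiber i f b H) := by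
  let P x : Path (f (i' x)) (f (i x)) := (J.evalAt x).map f.continuous
  let Q x : Path (f (i x)) b := H.evalAt x
  have hD : Continuous ↿fun x : I × F => dropInitial (P x.2) (Q x.2) x.1 :=
    continuous_dropInitial (f.continuous.comp (continuous_evalAt J)) (continuous_evalAt H)
  exact ⟨{
    toFun := fun x => dropInitial (P x.2) (Q x.2) 0 x.1
    continuous_toFun := hD.comp (f := fun x : I × F => ((0, x.2), x.1)) (by fun_prop)
    map_zero_left := fun x => (dropInitial (P x) (Q x) 0).source.trans (P x).source
    map_one_left := fun x => (dropInitial (P x) (Q x) 0).target }, ⟨{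
    toFun := fun x => HFiber.mk (J x) (dropInitial (P x.2) (Q x.2) x.1)
    continuous_toFun := HFiber.continuous_mk J.continuous hD
    map_zero_left := fun x => HFiber.ext (J.apply_zero x) fun _ => rfl
    map_one_left := fun x => HFiber.ext (J.apply_one x) fun t => dropInitial_one _ _ t }⟩⟩

theorem IsFiberSequence.of_homotopic (h : IsFiberSequence i f b) (hi : i'.Homotopic i) :
    IsFiberSequence i' f b := by
  obtain ⟨H, e, he⟩ := h
  obtain ⟨J⟩ := hi
  obtain ⟨H', hH'⟩ := exists_toHFiber_homotopic J H
  rw [← he] at hH'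
  exact ⟨H', {
    toFun := toHFiber i' f b H'
    invFun := e.invFun
    left_inv := ((ContinuousMap.Homotopic.refl e.invFun).comp hH').trans e.left_inv
    right_inv := (hH'.comp (ContinuousMap.Homotopic.refl e.invFun)).trans e.right_inv }, rfl⟩

theorem copiesMap_homotopic (k : ℕ) {A B : Type*} [TopologicalSpace A] [TopologicalSpace B]
    {g g' : C(A, B)} (h : g.Homotopic g') : (copiesMap k g).Homotopic (copiesMap k g') :=
  h.comp (.refl (⟨Sigma.snd, continuous_sigma fun _ => continuous_id⟩ : C(Copies k A, A)))

end FiberSequence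

section Nullhomotopic

variable {E B : Type*} [TopologicalSpace E] [TopologicalSpace B] {h : C(E, B)} {b : B}
  (K : h.Homotopy (ContinuousMap.const E b))

/-- The path to the base point traced by a point under a null-homotopy. -/
def nullPath (x : E) : Path (h x) b := K.evalAt x

variable {K} in
theorem continuous_nullPath {T : Type*} [TopologicalSpace T] {u : T → E} (hu : Continuous u) :
    Continuous ↿fun y => nullPath K (u y) :=
  (continuous_evalAt K).comp (hu.prodMap continuous_id)

/-- The map which turns each path of the homotopy fiber of a null-homotopic map into a loop, by
means of a null-homotopy. -/
def untwist : C(HFiber h b, E × Path b b) where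
  toFun y := (y.point, (nullPath K y.point).symm.trans y.path)
  continuous_toFun := HFiber.continuous_point.prodMk <| Path.continuous_uncurry_iff.1 <|
    Path.trans_continuous_family _
      (Path.symm_continuous_family _ (continuous_nullPath HFiber.continuous_point))
      _ HFiber.continuous_path

/-- The homotopy inverse of `untwist`. -/
def twist : C(E × Path b b, HFiber h b) where
  toFun x := HFiber.mk x.1 ((nullPath K x.1).trans x.2)
  continuous_toFun := HFiber.continuous_mk continuous_fst <|
    Path.trans_continuous_family _ (continuous_nullPath continuous_fst) _
      (Path.continuous_uncurry_iff.2 continuous_snd)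

theorem twist_comp_untwist_homotopic :
    ((twist K).comp (untwist K)).Homotopic (ContinuousMap.id _) := ⟨{
  toFun := fun x => HFiber.mk x.2.point (cancelLeft (nullPath K x.2.point) x.2.path x.1)
  continuous_toFun := HFiber.continuous_mk (HFiber.continuous_point.comp continuous_snd) <|
    continuous_cancelLeft (p := fun y : HFiber h b => nullPath K y.point) (q := fun y => y.path)
      (continuous_nullPath HFiber.continuous_point) HFiber.continuous_path
  map_zero_left := fun y => by
    rw [cancelLeft_zero]
    rfl
  map_one_left := fun y => by
    rw [cancelLeft_one]
    rfl }⟩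

theorem untwist_comp_twist_homotopic :
    ((untwist K).comp (twist K)).Homotopic (ContinuousMap.id _) := ⟨{
  toFun := fun x => (x.2.1, cancelLeft (nullPath K x.2.1).symm x.2.2 x.1)
  continuous_toFun := (continuous_fst.comp continuous_snd).prodMk <|
    Path.continuous_uncurry_iff.1 <| continuous_cancelLeft
      (T := E × Path b b) (p := fun x => (nullPath K x.1).symm) (q := fun x => x.2)
      (Path.symm_continuous_family _ (continuous_nullPath continuous_fst))
      (Path.continuous_uncurry_iff.2 continuous_snd)
  map_zero_left := fun x => by
    rw [cancelLeft_zero, Path.symm_symm]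
    rfl
  map_one_left := fun x => by
    rw [cancelLeft_one]
    rfl }⟩

/-- The homotopy fiber of a null-homotopic map is homotopy equivalent to the product of the source
of the map with the loop space of the target. -/
def nullFiberEquiv : HFiber h b ≃ₕ E × Path b b where
  toFun := untwist K
  invFun := twist K
  left_inv := twist_comp_untwist_homotopic K
  right_inv := untwist_comp_twist_homotopic K

end Nullhomotopic

/-- The map which sends the `j`-th copy of `A` to the slice `A × {φ j}`. -/
def copiesHomeomorph {k : ℕ} {A G : Type*} [TopologicalSpace A] [TopologicalSpace G]
    [DiscreteTopology G] {T : Set G} (φ : Fin k ≃ T) :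
    Copies k A ≃ₜ {x : A × G | x.2 ∈ T} where
  toFun x := ⟨(x.2, φ x.1), (φ x.1).2⟩
  invFun x := ⟨φ.symm ⟨x.1.2, x.2⟩, x.1.1⟩
  left_inv x := by simp
  right_inv x := by simp
  continuous_toFun := continuous_sigma fun j => by fun_prop
  continuous_invFun := by
    have h : Continuous fun x : Fin k × A => (⟨x.1, x.2⟩ : Copies k A) :=
      continuous_prod_of_discrete_left.2 fun j => @continuous_sigmaMk (Fin k) (fun _ => A) _ j
    exact h.comp (f := fun x : {x : A × G | x.2 ∈ T} => (φ.symm ⟨x.1.2, x.2⟩, x.1.1)) (by fun_prop)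

section Offset

variable {G : Type*} [AddGroup G] [TopologicalSpace G] [DiscreteTopology G]
  {X E : Type*} [TopologicalSpace X] [TopologicalSpace E] {D : Delooping G X} {h : C(E, X)}
  (K : h.Homotopy (ContinuousMap.const E D.base))

/-- The homotopy fiber of a null-homotopic map `h : E → BG` is homotopy equivalent to `E × G`. -/
def offsetEquiv : HFiber h D.base ≃ₕ E × G :=
  (nullFiberEquiv K).trans ((ContinuousMap.HomotopyEquiv.refl E).prodCongr D.loopEquiv)

/-- The component in `G` of a point of the homotopy fiber of `h` under `offsetEquiv`: the class of
the loop which runs back along the null-homotopy `K`, then along the path of the given point. -/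
def offset (y : HFiber h D.base) : G :=
  D.loopEquiv ((nullPath K y.point).symm.trans y.path)

theorem isFiberSequence_of_existsUnique_lift {E' : Type*} [TopologicalSpace E'] {f : C(E, X)}
    {p : C(E', E)} (hp : IsProperMap p) (K : (f.comp p).Homotopy (ContinuousMap.const E' D.base))
    {k : ℕ} {T : Set G} (φ : Fin k ≃ T)
    (hlift : ∀ y : HFiber f D.base,
      ∃! y' : HFiber (f.comp p) D.base, y'.total p = y ∧ offset K y' ∈ T) :
    IsFiberSequence (copiesMap k p) f D.base := by
  have hT : IsClopen {x : E' × G | x.2 ∈ T} := (isClopen_discrete T).preimage continuous_snd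
  let q (y : offsetEquiv K ⁻¹' {x : E' × G | x.2 ∈ T}) : HFiber f D.base := HFiber.total p y.1
  have hq : Function.Bijective q := by
    refine ⟨fun y y' hy => ?_, fun y => ?_⟩
    · exact Subtype.ext ((hlift (q y')).unique ⟨hy, y.2⟩ ⟨rfl, y'.2⟩)
    · obtain ⟨y', hy', -⟩ := hlift y
      exact ⟨⟨y', hy'.2⟩, hy'.1⟩
  have hclosed : IsClosedMap q := (HFiber.isClosedMap_total hp).comp
    (hT.isClosed.preimage (offsetEquiv K).continuous).isClosedMap_subtype_val
  let Q := (Equiv.ofBijective q hq).toHomeomorphOfContinuousClosed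
    ((HFiber.continuous_total p).comp continuous_subtype_val) hclosed
  let e : Copies k E' ≃ₕ HFiber f D.base := (copiesHomeomorph φ).toHomotopyEquiv.trans <|
    (restrictClopen (offsetEquiv K) hT).symm.trans Q.toHomotopyEquiv
  let W (x : Copies k E') : Path (f (p x.2)) D.base :=
    (nullPath K x.2).trans (D.loopEquiv.symm (φ x.1))
  refine ⟨{
    toFun := fun x => W x.2 x.1
    continuous_toFun := HFiber.continuous_path.comp
      (f := fun x : I × Copies k E' => (e x.2, x.1)) (by fun_prop)
    map_zero_left := fun x => (W x).source
    map_one_left := fun x => (W x).target }, e, ?_⟩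
  rfl

theorem offset_eq_loopEquiv_conj_add {E' : Type*} [TopologicalSpace E']
    {f : C(E, X)} {p : C(E', E)} (K : (f.comp p).Homotopy (ContinuousMap.const E' D.base))
    {y y' : HFiber (f.comp p) D.base} (h : y'.total p = y.total p) (μ : Path y.point y'.point)
    (ν : Path (p y.point) (p y.point)) (hν : ∀ t, p (μ t) = ν t) :
    offset K y' = D.loopEquiv ((nullPath K y.point).symm.trans
      ((ν.map f.continuous).trans (nullPath K y.point))) + offset K y := by
  have hpoint : f (p y.point) = f (p y'.point) := congrArg (fun z => f (HFiber.point z)) h.symm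
  have hpath (t : I) : y'.path t = y.path t :=
    congrArg (fun z : HFiber f D.base => z.path t) h
  let μ' : Path (f (p y.point)) (f (p y'.point)) := μ.map (f.comp p).continuous
  have hnull : ((ν.map f.continuous).trans ((nullPath K y'.point).cast hpoint rfl)).Homotopic
      (nullPath K y.point) := by
    have hsquare : (μ'.trans (nullPath K y'.point)).Homotopic (nullPath K y.point) :=
      (Path.Homotopic.map_trans_evalAt K μ).trans (Path.Homotopic.trans_refl _)
    convert hsquare using 1
    ext t
    simp [Path.trans_apply, μ', ← hν]
  rw [offset, offset, ← D.loopEquiv_trans]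
  refine Eq.trans ?_ (D.loopEquiv_eq_iff.2 (symm_trans_homotopic_of_trans_homotopic hnull y.path))
  congr 1
  ext t
  simp [Path.trans_apply, hpath]

/-- The left translate by `x` of a loop based at the unit of a topological monoid. -/
def translate {M : Type*} [MulOneClass M] [TopologicalSpace M] [ContinuousMul M] (x : M)
    (γ : Path (1 : M) 1) : Path x x :=
  (γ.map (continuous_const_mul x)).cast (mul_one x).symm (mul_one x).symm

theorem loopEquiv_conj_translate {M : Type*} [MulOneClass M] [TopologicalSpace M]
    [ContinuousMul M] [PreconnectedSpace E] {f : PointedMap (1 : M) D.base}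
    {p : C(E, M)} {K : (f.toMap.comp p).Homotopy (ContinuousMap.const E D.base)} {x₀ : E}
    (hx₀ : p x₀ = 1)
    (hK : (nullPath K x₀).Homotopic (f.basePath.cast (congrArg f.toMap hx₀) rfl))
    (γ : Path (1 : M) 1) (x : E) :
    D.loopEquiv ((nullPath K x).symm.trans
      (((translate (p x) γ).map f.toMap.continuous).trans (nullPath K x))) =
      D.loopEquiv (f.loopMap γ) := by
  let u (x : E) : Path D.base D.base := (nullPath K x).symm.trans
    (((translate (p x) γ).map f.toMap.continuous).trans (nullPath K x))
  have hu : Continuous u := by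
    have hnull := continuous_nullPath (K := K) continuous_id
    have htranslate : Continuous ↿fun x => (translate (p x) γ).map f.toMap.continuous := by
      have : Continuous fun x : E × I => f.toMap (p x.1 * γ x.2) := by fun_prop
      exact this
    exact Path.continuous_uncurry_iff.1 <|
      Path.trans_continuous_family _ (Path.symm_continuous_family _ hnull) _
        (Path.trans_continuous_family _ htranslate _ hnull)
  have hconst : D.loopEquiv (u x) = D.loopEquiv (u x₀) :=
    PreconnectedSpace.constant inferInstance (D.loopEquiv.continuous.comp hu)
  refine hconst.trans (D.loopEquiv_eq_iff.2 ?_)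
  convert hK.symm₂.hcomp ((Path.Homotopic.refl _).hcomp hK) using 1
  ext t
  simp [PointedMap.loopMap, Path.trans_apply, translate, hx₀]

end Offset

/-! ### Maps from the circle -/

theorem homeomorphCircle_coe (t : I) :
    AddCircle.homeomorphCircle (T := 1) one_ne_zero (t : ℝ) = circleLoop 1 t := by
  rw [AddCircle.homeomorphCircle_apply, AddCircle.toCircle_apply_mk]
  simp [circleLoop, mul_comm]

theorem circleLoop_one_surjective : Function.Surjective (circleLoop 1) := by
  have : Fact ((0 : ℝ) < 1) := ⟨one_pos⟩
  intro z
  obtain ⟨x, rfl⟩ := (AddCircle.homeomorphCircle (T := 1) one_ne_zero).surjective z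
  obtain ⟨t, ht, rfl⟩ : x ∈ ((↑) : ℝ → AddCircle (1 : ℝ)) '' Set.Icc 0 (0 + 1) := by
    rw [AddCircle.coe_image_Icc_eq]
    exact Set.mem_univ x
  rw [zero_add] at ht
  exact ⟨⟨t, ht⟩, (homeomorphCircle_coe ⟨t, ht⟩).symm⟩

theorem exists_apply_circleLoop_one_eq {Y : Type*} [TopologicalSpace Y] {x : Y} (p : Path x x) :
    ∃ f : C(Circle, Y), ∀ t, f (circleLoop 1 t) = p t := by
  have : Fact ((0 : ℝ) < 1) := ⟨one_pos⟩
  let e := AddCircle.homeomorphCircle (T := 1) one_ne_zero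
  have hp : Continuous (AddCircle.liftIco 1 0 p.extend) :=
    AddCircle.liftIco_zero_continuous (by simp) p.continuous_extend.continuousOn
  refine ⟨⟨_, hp.comp e.symm.continuous⟩, fun t => ?_⟩
  have ht : e.symm (circleLoop 1 t) = (t : ℝ) := e.symm_apply_eq.2 (homeomorphCircle_coe t).symm
  change AddCircle.liftIco 1 0 p.extend (e.symm (circleLoop 1 t)) = p t
  rw [ht]
  rcases t.2.2.lt_or_eq with h | h
  · rw [AddCircle.liftIco_zero_coe_apply ⟨t.2.1, h⟩, Path.extend_extends']
  · obtain rfl : t = 1 := Subtype.ext h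
    rw [Set.Icc.coe_one, AddCircle.coe_period, ← AddCircle.coe_zero,
      AddCircle.liftIco_zero_coe_apply ⟨le_rfl, one_pos⟩]
    simp

section Maps

variable {Y : Type*} [TopologicalSpace Y]

theorem exists_homotopy_apply_circleLoop_one {f g : C(Circle, Y)} (F : C(I × I, Y))
    (hF : ∀ s, F (s, 0) = F (s, 1)) (hf : ∀ t, F (0, t) = f (circleLoop 1 t))
    (hg : ∀ t, F (1, t) = g (circleLoop 1 t)) :
    ∃ K : f.Homotopy g, ∀ s t, K (s, circleLoop 1 t) = F (s, t) := by
  let F' : C(I, C(I, Y)) := (F.comp ContinuousMap.prodSwap).curry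
  let p : Path (F' 0) (F' 0) := {
    toContinuousMap := F'
    source' := rfl
    target' := ContinuousMap.ext fun s => (hF s).symm }
  obtain ⟨Φ, hΦ⟩ := exists_apply_circleLoop_one_eq p
  have apply_eq (s t : I) : Φ (circleLoop 1 t) s = F (s, t) := DFunLike.congr_fun (hΦ t) s
  refine ⟨⟨⟨fun x => Φ x.2 x.1, by fun_prop⟩, fun z => ?_, fun z => ?_⟩, apply_eq⟩ <;>
    obtain ⟨t, rfl⟩ := circleLoop_one_surjective z
  · exact (apply_eq 0 t).trans (hf t)
  · exact (apply_eq 1 t).trans (hg t)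

/-- The homotopy of loops, in the parameter `s`, from `p` to `α⁻¹ ⬝ (p ⬝ α)` along `α`:
the loop `p` is the part of `α⁻¹ ⬝ (p ⬝ α)` over the interval `[1/2, 3/4]`. -/
def conjSquare {x y : Y} (p : Path x x) (α : Path x y) : C(I × I, Y) where
  toFun x := (α.symm.trans (p.trans α)).extend ((1 - x.1) * (1 / 2 + x.2 / 4) + x.1 * x.2)
  continuous_toFun := by
    have := (α.symm.trans (p.trans α)).continuous_extend
    fun_prop

theorem conjSquare_zero {x y : Y} (p : Path x x) (α : Path x y) (t : I) :
    conjSquare p α (0, t) = p t := by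
  have h0 := t.2.1
  have h1 := t.2.2
  simp only [conjSquare, ContinuousMap.coe_mk, Set.Icc.coe_zero, sub_zero, one_mul, zero_mul,
    add_zero]
  rw [Path.extend_trans_of_half_le _ _ (by linarith),
    Path.extend_trans_of_le_half _ _ (by linarith),
    ← Path.extend_extends' p]
  congr 1
  ring

theorem conjSquare_one {x y : Y} (p : Path x x) (α : Path x y) (t : I) :
    conjSquare p α (1, t) = (α.symm.trans (p.trans α)) t := by
  simp [conjSquare]

theorem conjSquare_apply_zero {x y : Y} (p : Path x x) (α : Path x y) (s : I) :
    conjSquare p α (s, 0) = α s := by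
  have h0 := s.2.1
  simp only [conjSquare, ContinuousMap.coe_mk, Set.Icc.coe_zero]
  rw [Path.extend_trans_of_le_half _ _ (by linarith), Path.extend_symm_apply,
    ← Path.extend_extends' α]
  congr 1
  ring

theorem conjSquare_apply_one {x y : Y} (p : Path x x) (α : Path x y) (s : I) :
    conjSquare p α (s, 1) = α s := by
  have h0 := s.2.1
  simp only [conjSquare, ContinuousMap.coe_mk, Set.Icc.coe_one]
  rw [Path.extend_trans_of_half_le _ _ (by linarith),
    Path.extend_trans_of_half_le _ _ (by linarith), ← Path.extend_extends' α]
  congr 1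
  ring

theorem exists_homotopy_of_conj_homotopic {f g : C(Circle, Y)} {y : Y} (hg : g 1 = y)
    (α : Path (f 1) y)
    (h : (α.symm.trans (((circleLoop 1).map f.continuous).trans α)).Homotopic
      (((circleLoop 1).map g.continuous).cast hg.symm hg.symm)) :
    ∃ K : f.Homotopy g, (K.evalAt 1).Homotopic (α.cast rfl hg) := by
  subst hg
  obtain ⟨H⟩ := h
  let q := α.symm.trans (((circleLoop 1).map f.continuous).trans α)
  obtain ⟨f', hf'⟩ := exists_apply_circleLoop_one_eq q
  obtain ⟨K, hK⟩ := exists_homotopy_apply_circleLoop_one (f := f) (g := f')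
    (conjSquare ((circleLoop 1).map f.continuous) α)
    (fun s => by rw [conjSquare_apply_zero, conjSquare_apply_one]) (fun t => conjSquare_zero _ _ t)
    (fun t => by rw [conjSquare_one, hf'])
  obtain ⟨L, hL⟩ := exists_homotopy_apply_circleLoop_one (f := f') (g := g) H.toContinuousMap
    (fun s => (H.source s).trans (H.target s).symm) (fun t => (H.apply_zero t).trans (hf' t).symm)
    (fun t => H.apply_one t)
  refine ⟨K.trans L, ?_⟩
  have hf'1 : f' 1 = g 1 := by simpa using hf' 0
  have hK1 : K.evalAt 1 = α.cast rfl hf'1 := by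
    ext s
    have := hK s 0
    rw [(circleLoop 1).source, conjSquare_apply_zero] at this
    exact this
  have hL1 : L.evalAt 1 = (Path.refl (g 1)).cast hf'1 rfl := by
    ext s
    have := hL s 0
    rw [(circleLoop 1).source] at this
    exact this.trans (H.source s)
  have htrace : (K.trans L).evalAt 1 = α.trans (Path.refl _) := by
    change (K.evalAt 1).trans (L.evalAt 1) = _
    rw [hK1, hL1]
    rfl
  rw [htrace]
  exact Path.Homotopic.trans_refl α

end Maps

/-! ### Power maps of the circle -/

/-- The `n`-th power map of the circle. -/
def powMap (n : ℕ) : C(Circle, Circle) := ⟨fun z => z ^ n, by fun_prop⟩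

theorem powMap_one (n : ℕ) : powMap n 1 = 1 := one_pow n

theorem powMap_circleLoop_one (n : ℕ) (t : I) : powMap n (circleLoop 1 t) = circleLoop n t := by
  change Circle.exp _ ^ n = Circle.exp _
  rw [← Circle.exp_natCast_mul]
  congr 1
  push_cast
  ring

theorem homotopic_powMap {n : ℕ} {g : PointedMap circleDelooping.base circleDelooping.base}
    (hg : Deloops circleDelooping circleDelooping g (AddMonoidHom.mulLeft (n : ℤ))) :
    g.toMap.Homotopic (powMap n) := by
  have hloop : (g.loopMap (circleLoop 1)).Homotopic (circleLoop n) := by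
    refine circleDelooping.loopEquiv_eq_iff.1 ((hg (circleLoop 1)).trans ?_)
    change (n : ℤ) * winding (circleLoop 1) = winding (circleLoop n)
    rw [winding_circleLoop, winding_circleLoop, mul_one]
  have hpow : ((circleLoop 1).map (powMap n).continuous).cast (powMap_one n).symm
      (powMap_one n).symm = circleLoop n :=
    Path.ext (funext (powMap_circleLoop_one n))
  obtain ⟨K, -⟩ := exists_homotopy_of_conj_homotopic (powMap_one n) g.basePath (hpow ▸ hloop)
  exact ⟨K⟩

theorem powMap_eq_powMap_iff {n : ℕ} (hn : n ≠ 0) {z z' : Circle} :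
    powMap n z' = powMap n z ↔ ∃ a : ℤ, z' = z * Circle.exp (a * (2 * Real.pi) / n) := by
  obtain ⟨x, rfl⟩ := Circle.exp_surjective z
  obtain ⟨x', rfl⟩ := Circle.exp_surjective z'
  simp only [powMap, ContinuousMap.coe_mk, ← Circle.exp_natCast_mul, ← Circle.exp_add,
    Circle.exp_eq_exp]
  constructor
  · rintro ⟨a, ha⟩
    refine ⟨a, 0, ?_⟩
    field_simp
    push_cast
    linarith
  · rintro ⟨a, b, hb⟩
    refine ⟨a + b * n, ?_⟩
    rw [hb]
    push_cast
    field_simp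
    ring

theorem powMap_surjective {n : ℕ} (hn : n ≠ 0) : Function.Surjective (powMap n) := by
  intro z
  obtain ⟨x, rfl⟩ := Circle.exp_surjective z
  refine ⟨Circle.exp (x / n), ?_⟩
  change Circle.exp (x / n) ^ n = Circle.exp x
  rw [← Circle.exp_natCast_mul]
  congr 1
  field_simp

section Monodromy

variable {G : Type*} [AddGroup G] [TopologicalSpace G] [DiscreteTopology G]
  {X : Type*} [TopologicalSpace X] {D : Delooping G X}

theorem exists_homotopy_comp_powMap_const {f : PointedMap (1 : Circle) D.base} {n : ℕ}
    (h : D.loopEquiv (f.loopMap (circleLoop n)) = 0) :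
    ∃ K : (f.toMap.comp (powMap n)).Homotopy (ContinuousMap.const Circle D.base),
      (nullPath K 1).Homotopic (f.basePath.cast (congrArg f.toMap (powMap_one n)) rfl) := by
  let α : Path (f.toMap.comp (powMap n) 1) D.base :=
    f.basePath.cast (congrArg f.toMap (powMap_one n)) rfl
  have hα : α.symm.trans (((circleLoop 1).map (f.toMap.comp (powMap n)).continuous).trans α) =
      f.loopMap (circleLoop n) := by
    ext t
    simp [PointedMap.loopMap, Path.trans_apply, powMap_circleLoop_one, α]
  rw [← D.loopEquiv_refl, D.loopEquiv_eq_iff, ← hα] at h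
  exact exists_homotopy_of_conj_homotopic (g := ContinuousMap.const Circle D.base) rfl α h

theorem offset_of_point_eq_mul_exp {f : PointedMap circleDelooping.base D.base} {c : G}
    (hf : Deloops circleDelooping D f (zmultiplesHom G c)) {n : ℕ} (hn : n ≠ 0)
    {K : (f.toMap.comp (powMap n)).Homotopy (ContinuousMap.const Circle D.base)}
    (hK : (nullPath K 1).Homotopic (f.basePath.cast (congrArg f.toMap (powMap_one n)) rfl))
    {y y' : HFiber (f.toMap.comp (powMap n)) D.base}
    (h : y'.total (powMap n) = y.total (powMap n)) (a : ℤ)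
    (hpoint : y'.point = y.point * Circle.exp (a * (2 * Real.pi) / n)) :
    offset K y' = a • c + offset K y := by
  have : PathConnectedSpace Circle := circleDelooping.connected
  let μ : Path y.point y'.point := {
    toFun := fun t => y.point * Circle.exp (t * (a * (2 * Real.pi) / n))
    source' := by simp
    target' := by simp [hpoint] }
  have hμ (t : I) : powMap n (μ t) = translate (powMap n y.point) (circleLoop a) t := by
    change (y.point * Circle.exp (t * (a * (2 * Real.pi) / n))) ^ n =
      y.point ^ n * Circle.exp (t * (a * (2 * Real.pi)))
    rw [mul_pow, ← Circle.exp_natCast_mul]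
    congr 2
    field_simp
  rw [offset_eq_loopEquiv_conj_add K h μ (translate (powMap n y.point) (circleLoop a)) hμ,
    loopEquiv_conj_translate (powMap_one n) hK]
  congr 1
  exact (hf (circleLoop a)).trans (congrArg (· • c) (winding_circleLoop a))

theorem existsUnique_lift_of_isComplement {f : PointedMap circleDelooping.base D.base} {c : G}
    (hf : Deloops circleDelooping D f (zmultiplesHom G c)) (hc : IsOfFinAddOrder c)
    {K : (f.toMap.comp (powMap (addOrderOf c))).Homotopy (ContinuousMap.const Circle D.base)}
    (hK : (nullPath K 1).Homotopic (f.basePath.cast (congrArg f.toMap (powMap_one _)) rfl))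
    {T : Set G} (hT : AddSubgroup.IsComplement (AddSubgroup.zmultiples c : Set G) T)
    (y : HFiber f.toMap D.base) :
    ∃! y' : HFiber (f.toMap.comp (powMap (addOrderOf c))) D.base,
      y'.total (powMap (addOrderOf c)) = y ∧ offset K y' ∈ T := by
  have hn : addOrderOf c ≠ 0 := hc.addOrderOf_pos.ne'
  rw [AddSubgroup.isComplement_iff_existsUnique_neg_add_mem] at hT
  obtain ⟨x₀, hx₀⟩ := powMap_surjective hn y.point
  obtain ⟨y₀, hy₀, hpoint₀⟩ := y.exists_total_eq hx₀
  obtain ⟨⟨_, a, rfl⟩, ha : -(a • c) + offset K y₀ ∈ T, -⟩ := hT (offset K y₀)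
  obtain ⟨y₁, hy₁, hpoint₁⟩ := y.exists_total_eq <|
    ((powMap_eq_powMap_iff hn).2 ⟨-a, rfl⟩).trans hx₀
  have hoffset₁ : offset K y₁ ∈ T := by
    rw [← neg_zsmul] at ha
    rwa [offset_of_point_eq_mul_exp hf hn hK (hy₁.trans hy₀.symm) (-a) (hpoint₀ ▸ hpoint₁)]
  refine ⟨y₁, ⟨hy₁, hoffset₁⟩, fun y₂ ⟨hy₂, hoffset₂⟩ => ?_⟩
  have htotal : y₂.total (powMap _) = y₁.total (powMap _) := hy₂.trans hy₁.symm
  obtain ⟨b, hb⟩ := (powMap_eq_powMap_iff hn).1 (congrArg HFiber.point htotal)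
  rw [offset_of_point_eq_mul_exp hf hn hK htotal b hb] at hoffset₂
  have hbc : b • c = 0 := by
    have := (hT (offset K y₁)).unique (y₁ := ⟨(-b) • c, -b, rfl⟩) (y₂ := 0)
      (by simpa using hoffset₂) (by simpa using hoffset₁)
    simpa using congrArg Subtype.val this
  obtain ⟨d, rfl⟩ := addOrderOf_dvd_iff_zsmul_eq_zero.2 hbc
  refine HFiber.ext_total ?_ htotal
  have : ((addOrderOf c * d : ℤ) : ℝ) * (2 * Real.pi) / addOrderOf c = d * (2 * Real.pi) := by
    push_cast
    field_simp
  rw [hb, this, Circle.exp_int_mul_two_pi, mul_one]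

theorem isFiberSequence_copiesMap_powMap [Finite G] {f : PointedMap circleDelooping.base D.base}
    {c : G} (hf : Deloops circleDelooping D f (zmultiplesHom G c)) :
    IsFiberSequence (copiesMap (AddSubgroup.zmultiples c).index (powMap (addOrderOf c))) f.toMap
      D.base := by
  have hnull : D.loopEquiv (f.loopMap (circleLoop (addOrderOf c))) = 0 := by
    refine (hf (circleLoop (addOrderOf c))).trans ?_
    change winding (circleLoop (addOrderOf c)) • c = 0
    rw [winding_circleLoop, natCast_zsmul, addOrderOf_nsmul_eq_zero]
  obtain ⟨K, hK⟩ := exists_homotopy_comp_powMap_const hnull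
  obtain ⟨T, hT, -⟩ := (AddSubgroup.zmultiples c).exists_isComplement_right 0
  exact isFiberSequence_of_existsUnique_lift (powMap _).continuous.isProperMap K
    (Finite.equivFinOfCardEq hT.card_right).symm
    (existsUnique_lift_of_isComplement hf (isOfFinAddOrder_of_finite c) hK hT)

end Monodromy

theorem addOrderOf_intCast_zmod {m : ℕ} [NeZero m] (l : ℤ) :
    addOrderOf (l : ZMod m) = m / Int.gcd l m := by
  obtain ⟨a, rfl | rfl⟩ := l.eq_nat_or_neg <;>
    simp [addOrderOf_neg, ZMod.addOrderOf_coe a (NeZero.ne m), Nat.gcd_comm]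

theorem index_zmultiples_intCast_zmod {m : ℕ} [NeZero m] (l : ℤ) :
    (AddSubgroup.zmultiples (l : ZMod m)).index = Int.gcd l m := by
  have hgcd : 0 < Int.gcd l m := Int.gcd_pos_of_ne_zero_right _ (by simpa using NeZero.ne m)
  have hdvd : Int.gcd l m ∣ m := Nat.gcd_dvd_right _ _
  have hcard := (AddSubgroup.zmultiples (l : ZMod m)).index_mul_card
  rw [Nat.card_zmultiples, addOrderOf_intCast_zmod, Nat.card_zmod] at hcard
  exact Nat.eq_of_mul_eq_mul_right (Nat.div_pos (Nat.le_of_dvd (NeZero.pos m) hdvd) hgcd)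
    (hcard.trans (Nat.mul_div_cancel' hdvd).symm)

theorem mainTheorem5_general {G X : Type*} [AddGroup G] [Finite G] [TopologicalSpace G]
    [DiscreteTopology G] [TopologicalSpace X] {D : Delooping G X}
    {f : PointedMap circleDelooping.base D.base} {c : G}
    (hf : Deloops circleDelooping D f (zmultiplesHom G c)) :
    Nonempty (HFiber f.toMap D.base ≃ₕ Copies (AddSubgroup.zmultiples c).index Circle) ∧
    ∀ g : PointedMap circleDelooping.base circleDelooping.base,
      Deloops circleDelooping circleDelooping g (AddMonoidHom.mulLeft (addOrderOf c : ℤ)) →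
      IsFiberSequence (copiesMap (AddSubgroup.zmultiples c).index g.toMap) f.toMap D.base := by
  have hpow := isFiberSequence_copiesMap_powMap hf
  refine ⟨?_, fun g hg => hpow.of_homotopic (copiesMap_homotopic _ (homotopic_powMap hg))⟩
  obtain ⟨-, e, -⟩ := hpow
  exact ⟨e.symm⟩

end FibSeq

end

theorem mainTheorem5 {X : Type*} [TopologicalSpace X] (m : ℕ) (hm : 0 < m) (l : ℤ)
    (BZm : FibSeq.Delooping (ZMod m) X)
    (f : FibSeq.PointedMap FibSeq.circleDelooping.base BZm.base)
    (hf : FibSeq.Deloops FibSeq.circleDelooping BZm f (zmultiplesHom (ZMod m) (l : ZMod m))) :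
    Nonempty (ContinuousMap.HomotopyEquiv (FibSeq.HFiber f.toMap BZm.base)
      (FibSeq.Copies (Int.gcd l m) Circle)) ∧
    ∀ g : FibSeq.PointedMap FibSeq.circleDelooping.base FibSeq.circleDelooping.base,
      FibSeq.Deloops FibSeq.circleDelooping FibSeq.circleDelooping g
        (AddMonoidHom.mulLeft ((m / Int.gcd l m : ℕ) : ℤ)) →
      FibSeq.IsFiberSequence (FibSeq.copiesMap (Int.gcd l m) g.toMap) f.toMap BZm.base := by
  have : NeZero m := ⟨hm.ne'⟩
  rw [← FibSeq.addOrderOf_intCast_zmod, ← FibSeq.index_zmultiples_intCast_zmod]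
  exact FibSeq.mainTheorem5_general hf
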